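/- For an integral domain $R$, call $R$ \emph{atomic} if every nonzero nonunit of $R$ is a (finite) product of irreducibles, and \emph{antimatter} if $R$ has no irreducible elements. An element $x \in R$ \emph{satisfies ACCP} if every ascending chain of principal ideals of $R$ starting at $Rx$ eventually stabilizes, and $R$ is \emph{weak-ACCP} if it is atomic and every nonempty finite subset $S$ of $R \setminus \{0\}$ has a common divisor $d \in R$ such that $\frac{s}{d}$ satisfies ACCP for some $s \in S$. Let $F$ be a field, and let $(p_n)_{n \ge 1}$ and $(q_n)_{n \ge 1}$ be sequences of odd primes such that $p_n < q_n < p_{n+1}$ for every $n \ge 1$. Let \[ G_1 = \Big\langle \frac{1}{2^n p_n} \;\Big|\; n \ge 1 \Big\rangle \quad\text{and}\quad G_2 = \Big\langle \frac{1}{2^n q_n} \;\Big|\; n \ge 1 \Big\rangle \] be the additive submonoids of $\mathbb{Q}_{\ge 0}$ generated by the indicated elements. For $i \in \{1,2\}$, let $F[G_i]$ be the monoid algebra of polynomial expressions with coefficients in $F$ and exponents in $G_i$, and let $L_i$ be the localization of $F[G_i]$ at the multiplicative set of all elements of order $0$ (those whose support has minimum $0$, that is, whose constant coefficient is nonzero),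 regarded as a subring of $F(\mathbb{Q})$, the field of fractions of the group algebra $F[\mathbb{Q}]$. Then $L_1$ and $L_2$ are weak-ACCP domains, while $L_1 \cap L_2$ is antimatter and is not atomic. Consequently, there exist a field $K$ and two weak-ACCP subrings of $K$ whose intersection is not weak-ACCP, and there exist a field $K$ and two atomic subrings of $K$ whose intersection is not atomic. -/

import Mathlib

open scoped NNRat

/-- An integral domain is atomic if every nonzero nonunit is a product of irreducibles. -/
def IsAtomicDomain (R : Type*) [CommRing R] [IsDomain R] : Prop :=
  ∀ x : R, x ≠ 0 → ¬ IsUnit x →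
    ∃ s : Multiset R, (∀ a ∈ s, Irreducible a) ∧ s.prod = x

/-- An integral domain is antimatter if it has no irreducible elements. -/
def IsAntimatterDomain (R : Type*) [CommRing R] [IsDomain R] : Prop :=
  ∀ a : R, ¬ Irreducible a

/-- An element `x` satisfies ACCP if every ascending chain of principal ideals starting at `Rx`
eventually stabilizes. -/
def SatisfiesACCP {R : Type*} [CommRing R] [IsDomain R] (x : R) : Prop :=
  ∀ c : ℕ → R, c 0 = x → Monotone (fun n => Ideal.span {c n}) →
    ∃ N, ∀ n, N ≤ n → Ideal.span {c n} = Ideal.span {c N}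

/-- An integral domain is weak-ACCP if it is atomic and every nonempty finite set `S` of nonzero
elements has a common divisor `d` such that `s / d` satisfies ACCP for some `s ∈ S`. -/
def IsWeakACCPDomain (R : Type*) [CommRing R] [IsDomain R] : Prop :=
  IsAtomicDomain R ∧
    ∀ S : Finset R, S.Nonempty → (0 : R) ∉ S →
      ∃ d : R, (∀ s ∈ S, d ∣ s) ∧ ∃ s ∈ S, ∃ t : R, s = d * t ∧ SatisfiesACCP t

/-- The additive submonoid of `ℚ≥0` generated by the numbers `1 / (2 ^ n * p n)` for `n ≥ 1`. -/
def gramsMonoid (p : ℕ → ℕ) : AddSubmonoid ℚ≥0 :=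
  AddSubmonoid.closure {x | ∃ n : ℕ, 1 ≤ n ∧ x = 1 / (2 ^ n * (p n : ℚ≥0))}

/-- The field `F(ℚ)` of fractions of the group algebra `F[ℚ]`. -/
abbrev RatFractions (F : Type*) [Field F] : Type _ := FractionRing (AddMonoidAlgebra F ℚ)

/-- The multiplicative set of the elements of order `0` of `F[G]`, that is, those whose support has
least element `0`. -/
def orderZero (F : Type*) [Field F] (G : AddSubmonoid ℚ≥0) :
    Submonoid (AddMonoidAlgebra F G) where
  carrier := {f | IsLeast (f.coeff.support : Set G) 0}
  one_mem' := ⟨by simp, fun x _ => (zero_le : 0 ≤ x.1)⟩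
  mul_mem' := by
    intro f g hf hg
    refine ⟨?_, fun x _ => (zero_le : 0 ≤ x.1)⟩
    have hf0 : f.coeff 0 ≠ 0 := by simpa using hf.1
    have hg0 : g.coeff 0 ≠ 0 := by simpa using hg.1
    have hu : UniqueAdd f.coeff.support g.coeff.support 0 0 := by
      intro a b _ _ hab
      rw [add_zero] at hab
      have h : a.1 + b.1 = 0 := congrArg Subtype.val hab
      exact ⟨Subtype.ext (add_eq_zero.mp h).1, Subtype.ext (add_eq_zero.mp h).2⟩
    have h := AddMonoidAlgebra.coeff_mul_add_of_uniqueAdd hu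
    rw [add_zero] at h
    simpa [h] using mul_ne_zero hf0 hg0

/-- The inclusion of additive monoids `G → ℚ`. -/
def inclRat (G : AddSubmonoid ℚ≥0) : G →+ ℚ :=
  (NNRat.coeHom : ℚ≥0 →+* ℚ).toAddMonoidHom.comp G.subtype

/-- The canonical embedding `F[G] → F[ℚ] → F(ℚ)`. -/
noncomputable def toRatFractions (F : Type*) [Field F] (G : AddSubmonoid ℚ≥0) :
    AddMonoidAlgebra F G →+* RatFractions F :=
  (algebraMap (AddMonoidAlgebra F ℚ) (RatFractions F)).comp
    (AddMonoidAlgebra.mapDomainRingHom F (inclRat G))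

theorem isUnit_toRatFractions (F : Type*) [Field F] (G : AddSubmonoid ℚ≥0)
    (s : orderZero F G) : IsUnit (toRatFractions F G s) := by
  have hinj : Function.Injective (inclRat G) :=
    fun a b h => Subtype.ext (NNRat.coe_injective h)
  have hs : (s : AddMonoidAlgebra F G) ≠ 0 := by
    intro h
    have h0 : IsLeast ((s : AddMonoidAlgebra F G).coeff.support : Set G) 0 := s.2
    simpa [h] using h0.1
  refine isUnit_iff_ne_zero.mpr fun h => hs ?_
  have h1 : AddMonoidAlgebra.mapDomainRingHom F (inclRat G) (s : AddMonoidAlgebra F G) = 0 :=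
    IsFractionRing.injective (AddMonoidAlgebra F ℚ) (RatFractions F) (by rw [map_zero]; exact h)
  exact AddMonoidAlgebra.mapDomain_injective hinj (by rw [AddMonoidAlgebra.mapDomain_zero]; exact h1)

/-- The localization of `F[G]` at the elements of order `0`, as a subring of `F(ℚ)`: the image of
the localization under the canonical map induced by `F[G] → F(ℚ)`. -/
noncomputable def orderZeroLocalization (F : Type*) [Field F] (G : AddSubmonoid ℚ≥0) :
    Subring (RatFractions F) :=
  (IsLocalization.lift (M := orderZero F G) (S := Localization (orderZero F G))
    (isUnit_toRatFractions F G)).range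

/-! In each monoid `G_i`, carrying copies of a generator past its prime writes every exponent as a
dyadic part plus a reduced sum, in which every coefficient is below its prime. Reading coefficients
modulo these primes shows that a reduced sum has only one expression in the generators, hence
bounded sum length (`sumLengthLE_of_coe_eq_gramsWeight`).

A product of `k` elements without constant term has only exponents that are sums of `k` nonzero
ones, so one exponent of bounded sum length in a numerator bounds the number of nonunit factors
(`factorLengthLE_of_mul_eq`). Given finitely many nonzero elements, the monomial of the least dyadic
part among all exponents of the numerators divides every one of them and leaves such an exponent in
one quotient. That quotient satisfies ACCP and factors; monomials factor because those of the
generators are irreducible.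

The intersection is the localization for the nonnegative dyadics `D`. If `f / s = g / t`, discarding
from `f * t = s * g` the exponents not integral at all `q_n` commutes with multiplication by
`F[G_1]` and sends `F[G_2]` to `F[D]`, so `f / s = g' / t'` over `D`. There half the least exponent
splits off any nonunit, so no irreducible exists. -/

/-- Every product of nonunits dividing `x` has at most `k` factors. -/
def FactorLengthLE {R : Type*} [CommRing R] (x : R) (k : ℕ) : Prop :=
  ∀ m : Multiset R, (∀ a ∈ m, ¬ IsUnit a) → m.prod ∣ x → Multiset.card m ≤ k

/-- Every decomposition of `g` as a sum of nonzero elements has at most `k` summands. -/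
def SumLengthLE {M : Type*} [AddCommMonoid M] (g : M) (k : ℕ) : Prop :=
  ∀ m : Multiset M, 0 ∉ m → m.sum = g → Multiset.card m ≤ k

theorem SumLengthLE.of_add_eq {M : Type*} [AddCommMonoid M] {a b g : M} {k : ℕ}
    (h : SumLengthLE g k) (hab : a + b = g) : SumLengthLE a k := by
  intro m hm hs
  by_cases hb : b = 0
  · exact h m hm (by rw [hs, ← hab, hb, add_zero])
  · have := h (b ::ₘ m) (by simp [hm, Ne.symm hb]) (by rw [Multiset.sum_cons, hs, add_comm, hab])
    rw [Multiset.card_cons] at this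
    omega

/-! ### Bounded factor length, ACCP and factorization into irreducibles -/

section CommRing

variable {R : Type*} [CommRing R]

theorem FactorLengthLE.satisfiesACCP [IsDomain R] {x : R} {k : ℕ} (h : FactorLengthLE x k) :
    SatisfiesACCP x := by
  intro c hc hmono
  have hdvd : ∀ n, c (n + 1) ∣ c n := fun n =>
    Ideal.span_singleton_le_span_singleton.mp (hmono (Nat.le_succ n))
  choose e he using hdvd
  have hprod : ∀ n, x = c n * ∏ i ∈ Finset.range n, e i := by
    intro n
    induction n with
    | zero => simp [hc]
    | succ n ih => rw [Finset.prod_range_succ, ih, he n]; ring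
  have hfin : {i | ¬ IsUnit (e i)}.Finite := by
    -- Otherwise `k + 1` nonunit quotients occur in a single partial product, which divides `x`.
    by_contra hinf
    obtain ⟨t, ht, hcard⟩ := Set.Infinite.exists_subset_card_eq hinf (k + 1)
    have hsub : t ⊆ Finset.range (t.sup id + 1) := fun i hi =>
      Finset.mem_range.mpr (Nat.lt_succ_of_le (Finset.le_sup (f := id) hi))
    have := h (t.val.map e) (by
      intro a ha
      obtain ⟨i, hi, rfl⟩ := Multiset.mem_map.mp ha
      exact ht hi) ((Finset.prod_dvd_prod_of_subset _ _ e hsub).trans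
        (hprod (t.sup id + 1) ▸ dvd_mul_left _ _))
    rw [Multiset.card_map, Finset.card_val] at this
    omega
  obtain ⟨N, hN⟩ := hfin.bddAbove
  refine ⟨N + 1, fun n hn => ?_⟩
  induction n, hn using Nat.le_induction with
  | base => rfl
  | succ n hn ih =>
    rw [← ih, he n]
    have hu : IsUnit (e n) := by
      by_contra hu
      have : n ≤ N := hN hu
      omega
    exact (Ideal.span_singleton_mul_right_unit hu _).symm

/-- `x` is, up to a unit, a product of irreducibles. -/
def HasIrreducibleFactors (x : R) : Prop :=
  ∃ s : Multiset R, (∀ a ∈ s, Irreducible a) ∧ Associated s.prod x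

theorem IsUnit.hasIrreducibleFactors {x : R} (h : IsUnit x) : HasIrreducibleFactors x :=
  ⟨0, by simp, by simpa using (associated_one_iff_isUnit.mpr h).symm⟩

theorem Irreducible.hasIrreducibleFactors {x : R} (h : Irreducible x) :
    HasIrreducibleFactors x :=
  ⟨{x}, by simpa using h, by simp⟩

theorem HasIrreducibleFactors.mul {x y : R} (hx : HasIrreducibleFactors x)
    (hy : HasIrreducibleFactors y) : HasIrreducibleFactors (x * y) := by
  obtain ⟨s, hs, hsx⟩ := hx
  obtain ⟨t, ht, hty⟩ := hy
  refine ⟨s + t, fun a ha => ?_, by rw [Multiset.prod_add]; exact hsx.mul_mul hty⟩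
  exact (Multiset.mem_add.mp ha).elim (hs a) (ht a)

/-- Some irreducible factor is present since `x` is not a unit, and it absorbs the unit. -/
theorem HasIrreducibleFactors.exists_prod_eq {x : R} (hx : HasIrreducibleFactors x)
    (hu : ¬ IsUnit x) : ∃ s : Multiset R, (∀ a ∈ s, Irreducible a) ∧ s.prod = x := by
  obtain ⟨s, hs, u, hsu⟩ := hx
  obtain rfl | ⟨a, ha⟩ := s.empty_or_exists_mem
  · exact absurd (hsu ▸ by simp) hu
  · obtain ⟨t, rfl⟩ := Multiset.exists_cons_of_mem ha
    refine ⟨(a * u) ::ₘ t, fun b hb => ?_, ?_⟩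
    · rcases Multiset.mem_cons.mp hb with rfl | hb
      · exact (irreducible_mul_units u).mpr (hs a ha)
      · exact hs b (Multiset.mem_cons_of_mem hb)
    · rw [← hsu, Multiset.prod_cons, Multiset.prod_cons]; ring

/-- Induction on `k`: in a product of two nonunits, each factor has a strictly smaller bound. -/
theorem FactorLengthLE.hasIrreducibleFactors {k : ℕ} :
    ∀ {x : R}, FactorLengthLE x k → HasIrreducibleFactors x := by
  induction k with
  | zero =>
    intro x h
    by_contra hx
    have := h {x} (by
      intro a ha
      rw [Multiset.mem_singleton.mp ha]
      exact fun hu => hx hu.hasIrreducibleFactors) (by simp)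
    simp at this
  | succ k ih =>
    intro x h
    by_cases hu : IsUnit x
    · exact hu.hasIrreducibleFactors
    by_cases hi : Irreducible x
    · exact hi.hasIrreducibleFactors
    obtain ⟨a, b, rfl, ha, hb⟩ : ∃ a b, x = a * b ∧ ¬ IsUnit a ∧ ¬ IsUnit b := by
      simpa [irreducible_iff, hu, and_assoc] using hi
    have key : ∀ {a b : R}, FactorLengthLE (a * b) (k + 1) → ¬ IsUnit b →
        FactorLengthLE a k := by
      intro a b h hb m hm hd
      have := h (b ::ₘ m) (by simpa [hb] using hm)
        (by rw [Multiset.prod_cons, mul_comm]; exact mul_dvd_mul_right hd b)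
      rw [Multiset.card_cons] at this
      omega
    exact (ih (key h hb)).mul (ih (key (mul_comm a b ▸ h) ha))

end CommRing

/-! ### Factor length in the localization, read off exponents -/

section Localization

variable {F : Type*} [Field F] {G : AddSubmonoid ℚ≥0}

theorem AddSubmonoid.nnrat_le_of_add_eq {a b g : G} (h : a + b = g) : a ≤ g := by
  subst h
  exact (le_add_of_nonneg_right (zero_le : 0 ≤ b.1) : a.1 ≤ a.1 + b.1)

theorem mem_orderZero {f : AddMonoidAlgebra F G} : f ∈ orderZero F G ↔ f.coeff 0 ≠ 0 :=
  ⟨fun h => by simpa using h.1, fun h => ⟨by simpa using h, fun x _ => (zero_le : 0 ≤ x.1)⟩⟩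

theorem coeff_mul_zero (f g : AddMonoidAlgebra F G) :
    (f * g).coeff 0 = f.coeff 0 * g.coeff 0 := by
  have hu : UniqueAdd f.coeff.support g.coeff.support 0 0 := by
    intro a b _ _ hab
    rw [add_zero] at hab
    have h : a.1 + b.1 = 0 := congrArg Subtype.val hab
    exact ⟨Subtype.ext (add_eq_zero.mp h).1, Subtype.ext (add_eq_zero.mp h).2⟩
  simpa using AddMonoidAlgebra.coeff_mul_add_of_uniqueAdd hu

theorem inclRat_injective (G : AddSubmonoid ℚ≥0) : Function.Injective (inclRat G) :=
  fun _ _ h => Subtype.ext (NNRat.coe_injective h)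

theorem toRatFractions_injective (F : Type*) [Field F] (G : AddSubmonoid ℚ≥0) :
    Function.Injective (toRatFractions F G) :=
  (IsFractionRing.injective (AddMonoidAlgebra F ℚ) (RatFractions F)).comp
    (AddMonoidAlgebra.mapDomain_injective (inclRat_injective G))

theorem mem_orderZeroLocalization {x : RatFractions F} :
    x ∈ orderZeroLocalization F G ↔ ∃ f, ∃ s ∈ orderZero F G,
      x * toRatFractions F G s = toRatFractions F G f := by
  constructor
  · rintro ⟨y, rfl⟩
    obtain ⟨⟨f, s⟩, hfs⟩ := IsLocalization.surj (orderZero F G) y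
    refine ⟨f, s, s.2, ?_⟩
    have := congrArg (IsLocalization.lift (M := orderZero F G) (isUnit_toRatFractions F G)) hfs
    simpa using this
  · rintro ⟨f, s, hs, h⟩
    refine ⟨IsLocalization.mk' _ f ⟨s, hs⟩, ?_⟩
    rw [IsLocalization.lift_mk'_spec, ← h, mul_comm]

/-- The embedding of `F[G]` into its localization at the elements of order `0`. -/
noncomputable def toOrderZeroLocalization (F : Type*) [Field F] (G : AddSubmonoid ℚ≥0) :
    AddMonoidAlgebra F G →+* orderZeroLocalization F G :=
  (toRatFractions F G).codRestrict _ fun f =>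
    mem_orderZeroLocalization.mpr ⟨f, 1, one_mem _, by simp⟩

local notation "ψ" => toOrderZeroLocalization F G

theorem toOrderZeroLocalization_injective : Function.Injective ψ := fun _ _ h =>
  toRatFractions_injective F G (congrArg Subtype.val h)

theorem exists_mul_toOrderZeroLocalization_eq (x : orderZeroLocalization F G) :
    ∃ f, ∃ s ∈ orderZero F G, x * ψ s = ψ f := by
  obtain ⟨f, s, hs, h⟩ := mem_orderZeroLocalization.mp x.2
  exact ⟨f, s, hs, Subtype.ext h⟩

theorem isUnit_toOrderZeroLocalization_of_mem {s : AddMonoidAlgebra F G}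
    (hs : s ∈ orderZero F G) : IsUnit (ψ s) := by
  have hu := isUnit_toRatFractions F G ⟨s, hs⟩
  refine IsUnit.of_mul_eq_one ⟨(toRatFractions F G s)⁻¹, mem_orderZeroLocalization.mpr
    ⟨1, s, hs, ?_⟩⟩ (Subtype.ext ?_)
  · rw [inv_mul_cancel₀ hu.ne_zero, map_one]
  · exact mul_inv_cancel₀ hu.ne_zero

theorem isUnit_toOrderZeroLocalization_iff {f : AddMonoidAlgebra F G} :
    IsUnit (ψ f) ↔ f.coeff 0 ≠ 0 := by
  refine ⟨fun h => ?_, fun h => isUnit_toOrderZeroLocalization_of_mem (mem_orderZero.mpr h)⟩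
  obtain ⟨y, hy⟩ := h.exists_right_inv
  obtain ⟨g, s, hs, hg⟩ := exists_mul_toOrderZeroLocalization_eq y
  have hfg : f * g = s := toOrderZeroLocalization_injective (F := F) (G := G) (by
    rw [map_mul, ← hg, ← mul_assoc, hy, one_mul])
  have := mem_orderZero.mp hs
  rw [← hfg, coeff_mul_zero] at this
  exact left_ne_zero_of_mul this

theorem isUnit_iff_of_mul_eq {x : orderZeroLocalization F G} {f s : AddMonoidAlgebra F G}
    (hs : s ∈ orderZero F G) (h : x * ψ s = ψ f) : IsUnit x ↔ f.coeff 0 ≠ 0 := by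
  rw [← isUnit_toOrderZeroLocalization_iff, ← h]
  exact (isUnit_toOrderZeroLocalization_of_mem hs).mul_right_iff.symm

theorem exists_multiset_of_forall_not_isUnit (m : Multiset (orderZeroLocalization F G))
    (hm : ∀ a ∈ m, ¬ IsUnit a) :
    ∃ h : Multiset (AddMonoidAlgebra F G), ∃ s ∈ orderZero F G, (∀ f ∈ h, f.coeff 0 = 0) ∧
      Multiset.card h = Multiset.card m ∧ m.prod * ψ s = ψ h.prod := by
  induction m using Multiset.induction_on with
  | empty => exact ⟨0, 1, one_mem _, by simp, by simp, by simp⟩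
  | cons a m ih =>
    obtain ⟨h, s, hs, hh, hcard, hprod⟩ := ih fun b hb => hm b (Multiset.mem_cons_of_mem hb)
    obtain ⟨f, t, ht, hf⟩ := exists_mul_toOrderZeroLocalization_eq a
    have hf0 : f.coeff 0 = 0 := by
      have := hm a (Multiset.mem_cons_self a m)
      rw [isUnit_iff_of_mul_eq ht hf] at this
      exact not_not.mp this
    refine ⟨f ::ₘ h, t * s, mul_mem ht hs, by simpa [hf0] using hh, by simp [hcard], ?_⟩
    rw [Multiset.prod_cons, Multiset.prod_cons, map_mul, map_mul, ← hf, ← hprod]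
    ring

theorem exists_multiset_sum_eq_of_coeff_prod_ne_zero (h : Multiset (AddMonoidAlgebra F G))
    (hh : ∀ f ∈ h, f.coeff 0 = 0) (g : G) (hg : h.prod.coeff g ≠ 0) :
    ∃ m : Multiset G, 0 ∉ m ∧ Multiset.card m = Multiset.card h ∧ m.sum = g := by
  classical
  induction h using Multiset.induction_on generalizing g with
  | empty =>
    refine ⟨0, by simp, rfl, ?_⟩
    by_contra hne
    exact hg (by simp [AddMonoidAlgebra.one_def, show ¬ (0 = g) from hne])
  | cons f h ih =>
    rw [Multiset.prod_cons] at hg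
    obtain ⟨a, ha, b, hb, rfl⟩ := Finset.mem_add.mp
      (AddMonoidAlgebra.support_coeff_mul_subset f h.prod (Finsupp.mem_support_iff.mpr hg))
    obtain ⟨m, hm0, hcard, rfl⟩ := ih (fun k hk => hh k (Multiset.mem_cons_of_mem hk)) b
      (Finsupp.mem_support_iff.mp hb)
    refine ⟨a ::ₘ m, ?_, by simp [hcard], by simp⟩
    rw [Multiset.mem_cons, not_or]
    refine ⟨?_, hm0⟩
    rintro rfl
    exact Finsupp.mem_support_iff.mp ha (hh f (Multiset.mem_cons_self f h))

/-- If some exponent of `f` has bounded sum length, then so does a least such exponent, and it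
survives multiplication by an element of order `0`. -/
theorem exists_coeff_mul_ne_zero_of_sumLengthLE {f s : AddMonoidAlgebra F G}
    (hs : s ∈ orderZero F G) {g : G} {k : ℕ} (hg : SumLengthLE g k) (hfg : f.coeff g ≠ 0) :
    ∃ g₀, SumLengthLE g₀ k ∧ (f * s).coeff g₀ ≠ 0 := by
  classical
  obtain ⟨g₀, hg₀, hmin⟩ := (f.coeff.support.filter fun g => SumLengthLE g k).exists_min_image id
    ⟨g, by simp [hfg, hg]⟩
  simp only [Finset.mem_filter, Finsupp.mem_support_iff, id] at hg₀ hmin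
  refine ⟨g₀, hg₀.2, ?_⟩
  -- A summand of `g₀` inherits the length bound, so minimality forces it to be `g₀` itself: nothing
  -- can cancel the term at `g₀`.
  have hu : UniqueAdd f.coeff.support s.coeff.support g₀ 0 := by
    intro a b ha _ hab
    rw [add_zero] at hab
    have h1 : a = g₀ := le_antisymm (AddSubmonoid.nnrat_le_of_add_eq hab)
      (hmin a ⟨Finsupp.mem_support_iff.mp ha, hg₀.2.of_add_eq hab⟩)
    exact ⟨h1, by simpa [h1] using hab⟩
  have h := AddMonoidAlgebra.coeff_mul_add_of_uniqueAdd hu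
  rw [add_zero] at h
  rw [h]
  exact mul_ne_zero hg₀.1 (mem_orderZero.mp hs)

/-- After clearing denominators, a bounded exponent survives on the left and appears on the right as
a sum with one nonzero exponent from each nonunit factor, plus a remainder. -/
theorem factorLengthLE_of_mul_eq {x : orderZeroLocalization F G} {f s : AddMonoidAlgebra F G}
    (h : x * ψ s = ψ f) {g : G} {k : ℕ} (hg : SumLengthLE g k)
    (hfg : f.coeff g ≠ 0) : FactorLengthLE x k := by
  classical
  rintro m hm ⟨y, hy⟩
  obtain ⟨l, t, ht, hl, hcard, hprod⟩ := exists_multiset_of_forall_not_isUnit m hm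
  obtain ⟨e, r, hr, he⟩ := exists_mul_toOrderZeroLocalization_eq y
  have heq : f * (t * r) = (s * e) * l.prod :=
    toOrderZeroLocalization_injective (F := F) (G := G) (by
      simp only [map_mul]
      rw [← h, ← hprod, ← he, hy]
      ring)
  obtain ⟨g₀, hlen, hne⟩ := exists_coeff_mul_ne_zero_of_sumLengthLE (mul_mem ht hr) hg hfg
  rw [heq] at hne
  obtain ⟨a, -, b, hb, rfl⟩ := Finset.mem_add.mp
    (AddMonoidAlgebra.support_coeff_mul_subset _ _ (Finsupp.mem_support_iff.mpr hne))
  obtain ⟨m', hm0, hcard', hsum⟩ := exists_multiset_sum_eq_of_coeff_prod_ne_zero l hl b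
    (Finsupp.mem_support_iff.mp hb)
  rw [← hcard, ← hcard']
  exact hlen.of_add_eq (add_comm b a) m' hm0 hsum

theorem exists_eq_single_mul {f : AddMonoidAlgebra F G} {m : G}
    (h : ∀ g, f.coeff g ≠ 0 → ∃ e, g = m + e) :
    ∃ f' : AddMonoidAlgebra F G, f = AddMonoidAlgebra.single m 1 * f' ∧
      ∀ g, f'.coeff g = f.coeff (m + g) := by
  refine ⟨f.divOf m, ?_, fun g => rfl⟩
  conv_lhs => rw [← AddMonoidAlgebra.divOf_add_modOf f m]
  rw [AddMonoidAlgebra.of'_apply, add_eq_left]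
  ext g
  by_cases hg : ∃ d, g = m + d
  · simpa using AddMonoidAlgebra.coeff_modOf_of_exists_add f m g hg
  · rw [AddMonoidAlgebra.coeff_modOf_of_not_exists_add f m g hg]
    by_contra hne
    exact hg (h g hne)

end Localization

/-! ### Rationals integral at a prime -/

section PadicIntegral

/-- The subring of the `P`-integral rationals. -/
noncomputable def ratPadicInt (P : ℕ) [Fact P.Prime] : Subring ℚ :=
  (PadicInt.subring P).comap (Rat.castHom ℚ_[P])

variable {P : ℕ} [Fact P.Prime]

theorem mem_ratPadicInt {x : ℚ} : x ∈ ratPadicInt P ↔ ‖(x : ℚ_[P])‖ ≤ 1 := Iff.rfl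

theorem one_div_mem_ratPadicInt {n : ℕ} (h : P.Coprime n) :
    (1 / n : ℚ) ∈ ratPadicInt P := by
  rw [mem_ratPadicInt]
  push_cast
  rw [norm_div, Padic.norm_natCast_eq_one_iff.mpr h]
  simp

theorem dvd_of_div_mem_ratPadicInt {k : ℤ} {n : ℕ} (hn : n ≠ 0)
    (h : (k / (n * P) : ℚ) ∈ ratPadicInt P) : (P : ℤ) ∣ k := by
  have hP : (P : ℚ) ≠ 0 := by exact_mod_cast (Fact.out : P.Prime).ne_zero
  have hn' : (n : ℚ) ≠ 0 := by exact_mod_cast hn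
  have h2 : (k / P : ℚ) ∈ ratPadicInt P := by
    have := mul_mem (natCast_mem (ratPadicInt P) n) h
    convert this using 1
    field_simp
  rw [mem_ratPadicInt] at h2
  push_cast at h2
  have hP1 : (1 : ℝ) < P := by exact_mod_cast (Fact.out : P.Prime).one_lt
  rw [norm_div, Padic.norm_p, div_inv_eq_mul] at h2
  rw [← Padic.norm_intCast_lt_one_iff]
  nlinarith [norm_nonneg (k : ℚ_[P])]

end PadicIntegral

/-! ### Nonnegative dyadic rationals -/

section Dyadic

/-- The nonnegative dyadic rationals. -/
def nonnegDyadic : AddSubmonoid ℚ≥0 where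
  carrier := {x | ∃ k n : ℕ, x = k / 2 ^ n}
  zero_mem' := ⟨0, 0, by simp⟩
  add_mem' := by
    rintro _ _ ⟨k, n, rfl⟩ ⟨l, m, rfl⟩
    refine ⟨k * 2 ^ m + l * 2 ^ n, n + m, ?_⟩
    push_cast
    field_simp
    ring

theorem exists_add_eq_of_le_of_mem_nonnegDyadic {a b : ℚ≥0} (ha : a ∈ nonnegDyadic)
    (hb : b ∈ nonnegDyadic) (hab : a ≤ b) : ∃ e ∈ nonnegDyadic, b = a + e := by
  obtain ⟨k, n, rfl⟩ := ha
  obtain ⟨l, m, rfl⟩ := hb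
  rw [div_le_div_iff₀ (by positivity) (by positivity)] at hab
  have hle : k * 2 ^ m ≤ l * 2 ^ n := by exact_mod_cast hab
  obtain ⟨d, hd⟩ := Nat.exists_eq_add_of_le hle
  refine ⟨d / 2 ^ (n + m), ⟨d, n + m, rfl⟩, ?_⟩
  have hd' : (l : ℚ≥0) * 2 ^ n = k * 2 ^ m + d := by exact_mod_cast hd
  rw [pow_add]
  field_simp
  linear_combination hd'

theorem half_mem_nonnegDyadic {a : ℚ≥0} (ha : a ∈ nonnegDyadic) : a / 2 ∈ nonnegDyadic := by
  obtain ⟨k, n, rfl⟩ := ha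
  exact ⟨k, n + 1, by rw [pow_succ, div_div]⟩

theorem coe_mem_ratPadicInt_of_mem_nonnegDyadic {P : ℕ} [Fact P.Prime] (hP : Odd P) {x : ℚ≥0}
    (hx : x ∈ nonnegDyadic) : (x : ℚ) ∈ ratPadicInt P := by
  obtain ⟨k, n, rfl⟩ := hx
  have h : P.Coprime (2 ^ n) := (Nat.coprime_two_right.mpr hP).pow_right n
  have := mul_mem (natCast_mem (ratPadicInt P) k) (one_div_mem_ratPadicInt h)
  push_cast at this ⊢
  rwa [mul_one_div] at this

end Dyadic

/-! ### Formal sums of generators and their reduced forms -/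

section Weight

/-- The generator `1 / (2 ^ (n + 1) * r n)`. -/
def gramsGen (r : ℕ → ℕ) (n : ℕ) : ℚ≥0 := 1 / (2 ^ (n + 1) * (r n : ℚ≥0))

/-- The value of a formal sum of generators. -/
noncomputable def gramsWeight (r : ℕ → ℕ) : (ℕ →₀ ℕ) →ₗ[ℕ] ℚ≥0 :=
  Finsupp.linearCombination ℕ (gramsGen r)

theorem mem_gramsMonoid_iff {p : ℕ → ℕ} {x : ℚ≥0} :
    x ∈ gramsMonoid p ↔ ∃ c, gramsWeight (fun n => p (n + 1)) c = x := by
  have h : {x : ℚ≥0 | ∃ n : ℕ, 1 ≤ n ∧ x = 1 / (2 ^ n * (p n : ℚ≥0))} =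
      Set.range (gramsGen fun n => p (n + 1)) := by
    ext x
    constructor
    · rintro ⟨n, hn, rfl⟩
      exact ⟨n - 1, by simp [gramsGen, Nat.sub_add_cancel hn]⟩
    · rintro ⟨n, rfl⟩
      exact ⟨n + 1, by omega, rfl⟩
  rw [gramsMonoid, h, AddSubmonoid.mem_closure_range_iff]
  exact exists_congr fun c => eq_comm

variable {r : ℕ → ℕ}

theorem gramsWeight_single (n k : ℕ) :
    gramsWeight r (Finsupp.single n k) = k • gramsGen r n := by
  simp [gramsWeight]

theorem gramsWeight_eq_single_add_erase (c : ℕ →₀ ℕ) (n : ℕ) :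
    gramsWeight r c = c n • gramsGen r n + gramsWeight r (c.erase n) := by
  conv_lhs => rw [← Finsupp.single_add_erase n c]
  rw [map_add, gramsWeight_single]

theorem gramsWeight_ne_zero (hr : ∀ n, (r n).Prime) {c : ℕ →₀ ℕ} (hc : c ≠ 0) :
    gramsWeight r c ≠ 0 := by
  obtain ⟨n, hn⟩ := Finsupp.ne_iff.mp hc
  rw [gramsWeight_eq_single_add_erase c n, Ne, add_eq_zero, not_and_or]
  left
  have := (hr n).ne_zero
  simpa [gramsGen, this] using hn

theorem coe_gramsWeight_mem_ratPadicInt (hr : ∀ n, (r n).Prime) {P : ℕ} [Fact P.Prime]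
    (hP : Odd P) (c : ℕ →₀ ℕ) (hc : ∀ n, c n ≠ 0 → r n ≠ P) :
    (gramsWeight r c : ℚ) ∈ ratPadicInt P := by
  rw [gramsWeight, Finsupp.linearCombination_apply, Finsupp.sum, NNRat.cast_sum]
  refine sum_mem fun n hn => ?_
  have h : P.Coprime (2 ^ (n + 1) * r n) := ((Nat.coprime_two_right.mpr hP).pow_right _).mul_right
    ((Nat.coprime_primes Fact.out (hr n)).mpr (hc n (Finsupp.mem_support_iff.mp hn)).symm)
  have := mul_mem (natCast_mem (ratPadicInt P) (c n)) (one_div_mem_ratPadicInt h)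
  rw [gramsGen, nsmul_eq_mul]
  push_cast at this ⊢
  exact this

/-- Only the `n`-th generator has `r n` in its denominator, so the other terms are integral at `r n`
and drop out. -/
theorem dvd_sub_of_gramsWeight_sub_mem (hr : ∀ n, (r n).Prime) (hinj : Function.Injective r)
    (n : ℕ) [Fact (r n).Prime] (hodd : Odd (r n)) {c c' : ℕ →₀ ℕ}
    (h : (gramsWeight r c - gramsWeight r c' : ℚ) ∈ ratPadicInt (r n)) :
    (r n : ℤ) ∣ c n - c' n := by
  have herase : ∀ c : ℕ →₀ ℕ, (gramsWeight r (c.erase n) : ℚ) ∈ ratPadicInt (r n) := fun c =>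
    coe_gramsWeight_mem_ratPadicInt hr hodd _ fun m hm hmn => hm (by rw [hinj hmn]; simp)
  have := add_mem (sub_mem h (herase c)) (herase c')
  rw [gramsWeight_eq_single_add_erase c n, gramsWeight_eq_single_add_erase c' n] at this
  refine dvd_of_div_mem_ratPadicInt (n := 2 ^ (n + 1)) (by positivity) ?_
  convert this using 1
  simp only [gramsGen, nsmul_eq_mul]
  push_cast
  ring

theorem eq_of_gramsWeight_eq (hr : ∀ n, (r n).Prime) (hodd : ∀ n, Odd (r n))
    (hinj : Function.Injective r) {c c' : ℕ →₀ ℕ} (hc : ∀ n, c n < r n)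
    (h : gramsWeight r c' = gramsWeight r c) : c' = c := by
  -- The coefficients agree modulo `r n`, and `c n` is the least residue. The excess of `c'` over
  -- `c` then has weight `0`, hence vanishes.
  have hle : c ≤ c' := by
    intro n
    have : Fact (r n).Prime := ⟨hr n⟩
    have hd : (r n : ℤ) ∣ c n - c' n := dvd_sub_of_gramsWeight_sub_mem hr hinj n (hodd n)
      (by rw [h, sub_self]; exact zero_mem _)
    by_contra! hlt
    have := Int.le_of_dvd (by omega) hd
    have := hc n
    omega
  obtain ⟨e, rfl⟩ := exists_add_of_le hle
  rw [map_add, add_eq_left] at h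
  by_contra hne
  exact gramsWeight_ne_zero hr (c := e) (fun he => hne (by rw [he, add_zero])) h

theorem exists_nonnegDyadic_add_gramsWeight (hr : ∀ n, (r n).Prime) (c : ℕ →₀ ℕ) :
    ∃ m ∈ nonnegDyadic, ∃ c' : ℕ →₀ ℕ, (∀ n, c' n < r n) ∧
      gramsWeight r c = m + gramsWeight r c' := by
  -- Each block of `r n` copies of the `n`-th generator sums to the dyadic `1 / 2 ^ (n + 1)`.
  refine ⟨∑ n ∈ c.support, ((c n / r n : ℕ) : ℚ≥0) / 2 ^ (n + 1),
    sum_mem fun n _ => ⟨_, _, rfl⟩,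
    Finsupp.onFinset c.support (fun n => c n % r n) (fun n hn => ?_), fun n => ?_, ?_⟩
  · rw [Finsupp.mem_support_iff]
    rintro h
    simp [h] at hn
  · exact Nat.mod_lt _ (hr n).pos
  · simp only [gramsWeight, Finsupp.linearCombination_apply]
    rw [Finsupp.onFinset_sum _ (by simp), Finsupp.sum, ← Finset.sum_add_distrib]
    refine Finset.sum_congr rfl fun n _ => ?_
    have hne : (r n : ℚ≥0) ≠ 0 := by exact_mod_cast (hr n).ne_zero
    have hdm : (c n : ℚ≥0) = r n * (c n / r n : ℕ) + (c n % r n : ℕ) := by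
      exact_mod_cast (Nat.div_add_mod (c n) (r n)).symm
    simp only [gramsGen, nsmul_eq_mul]
    rw [hdm]
    field_simp

end Weight

/-! ### Sum length in the monoid -/

section GramsMonoid

variable {p : ℕ → ℕ}

theorem nonnegDyadic_le_gramsMonoid (hp : ∀ n, (p (n + 1)).Prime) :
    nonnegDyadic ≤ gramsMonoid p := by
  rintro _ ⟨k, n, rfl⟩
  -- The factor `2` offsets the index shift: generator `n` has `2 ^ (n + 1)` in its denominator.
  refine mem_gramsMonoid_iff.mpr ⟨Finsupp.single n (2 * k * p (n + 1)), ?_⟩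
  have hne : (p (n + 1) : ℚ≥0) ≠ 0 := by exact_mod_cast (hp n).ne_zero
  rw [gramsWeight_single, gramsGen, nsmul_eq_mul]
  push_cast
  field_simp
  ring

theorem sumLengthLE_of_coe_eq_gramsWeight (hp : ∀ n, (p (n + 1)).Prime)
    (hodd : ∀ n, Odd (p (n + 1))) (hinj : Function.Injective fun n => p (n + 1))
    {c : ℕ →₀ ℕ} (hc : ∀ n, c n < p (n + 1)) {g : gramsMonoid p}
    (hg : (g : ℚ≥0) = gramsWeight (fun n => p (n + 1)) c) : SumLengthLE g c.degree := by
  intro m hm hsum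
  choose ρ hρ using fun a : gramsMonoid p => mem_gramsMonoid_iff.mp a.2
  -- Expanding each summand in generators must reproduce the unique expression `c`, and each nonzero
  -- summand uses up at least one unit of its degree.
  have hc' : (m.map ρ).sum = c := by
    refine eq_of_gramsWeight_eq hp hodd hinj hc ?_
    rw [← hg, ← hsum, map_multiset_sum, Multiset.map_map]
    simp only [Function.comp_def, hρ]
    exact (map_multiset_sum (gramsMonoid p).subtype m).symm
  rw [← hc', map_multiset_sum]
  have := Multiset.card_nsmul_le_sum (s := (m.map ρ).map Finsupp.degree) (a := 1) (by
    intro x hx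
    simp only [Multiset.mem_map] at hx
    obtain ⟨_, ⟨a, ha, rfl⟩, rfl⟩ := hx
    rw [Nat.one_le_iff_ne_zero, Ne, Finsupp.degree_eq_zero_iff]
    intro h0
    have h1 := hρ a
    rw [h0, map_zero] at h1
    exact hm ((Subtype.ext h1 : (0 : gramsMonoid p) = a) ▸ ha))
  simpa using this

/-- Finitely many elements of the monoid have a common summand whose removal leaves one of them
with bounded sum length. -/
theorem exists_common_summand (hp : ∀ n, (p (n + 1)).Prime)
    (hodd : ∀ n, Odd (p (n + 1))) (hinj : Function.Injective fun n => p (n + 1))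
    (E : Finset (gramsMonoid p)) (hE : E.Nonempty) :
    ∃ m : gramsMonoid p, (∀ g ∈ E, ∃ e, g = m + e) ∧
      ∃ e k, m + e ∈ E ∧ SumLengthLE e k := by
  have hrep : ∀ g : gramsMonoid p, ∃ m ∈ nonnegDyadic, ∃ c : ℕ →₀ ℕ, (∀ n, c n < p (n + 1)) ∧
      (g : ℚ≥0) = m + gramsWeight (fun n => p (n + 1)) c := by
    intro g
    obtain ⟨c, hc⟩ := mem_gramsMonoid_iff.mp g.2
    rw [← hc]
    exact exists_nonnegDyadic_add_gramsWeight hp c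
  choose ν hν c hc hg using hrep
  have hle := nonnegDyadic_le_gramsMonoid hp
  have hw : ∀ g, gramsWeight (fun n => p (n + 1)) (c g) ∈ gramsMonoid p := fun g =>
    mem_gramsMonoid_iff.mpr ⟨_, rfl⟩
  -- The least dyadic part is a summand of all the others, and its removal from `g₀` leaves a
  -- reduced sum.
  obtain ⟨g₀, hg₀, hmin⟩ := E.exists_min_image ν hE
  refine ⟨⟨ν g₀, hle (hν g₀)⟩, fun g hgE => ?_, ⟨_, hw g₀⟩, (c g₀).degree, ?_, ?_⟩
  · obtain ⟨e, he, hge⟩ := exists_add_eq_of_le_of_mem_nonnegDyadic (hν g₀) (hν g) (hmin g hgE)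
    refine ⟨⟨e, hle he⟩ + ⟨_, hw g⟩, Subtype.ext ?_⟩
    rw [hg g, hge]
    exact add_assoc _ _ _
  · convert hg₀
    exact Subtype.ext (hg g₀).symm
  · exact sumLengthLE_of_coe_eq_gramsWeight hp hodd hinj (hc g₀) rfl

theorem sumLengthLE_gramsGen (hp : ∀ n, (p (n + 1)).Prime)
    (hodd : ∀ n, Odd (p (n + 1))) (hinj : Function.Injective fun n => p (n + 1)) (n : ℕ)
    {g : gramsMonoid p} (hg : (g : ℚ≥0) = gramsGen (fun n => p (n + 1)) n) :
    SumLengthLE g 1 := by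
  have := sumLengthLE_of_coe_eq_gramsWeight hp hodd hinj (c := Finsupp.single n 1) (g := g)
    (fun m => ?_) (by rw [gramsWeight_single, one_smul, hg])
  · simpa using this
  · rw [Finsupp.single_apply]
    split_ifs with h
    exacts [(hp m).one_lt, (hp m).pos]

end GramsMonoid

theorem FactorLengthLE.irreducible {R : Type*} [CommRing R] {x : R} (h : FactorLengthLE x 1)
    (hu : ¬ IsUnit x) : Irreducible x := by
  refine ⟨hu, fun a b hab => ?_⟩
  by_contra! hne
  have := h {a, b} (by simpa using hne) (by simp [hab])
  simp at this

theorem irreducible_toOrderZeroLocalization_single {F : Type*} [Field F] {G : AddSubmonoid ℚ≥0}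
    {g : G} (hg0 : g ≠ 0) (hg : SumLengthLE g 1) :
    Irreducible (toOrderZeroLocalization F G (AddMonoidAlgebra.single g 1)) := by
  refine FactorLengthLE.irreducible (factorLengthLE_of_mul_eq (s := 1)
    (f := AddMonoidAlgebra.single g 1) (by rw [map_one, mul_one]) hg (by simp)) ?_
  rw [isUnit_toOrderZeroLocalization_iff, not_not]
  exact Finsupp.single_eq_of_ne hg0.symm

/-! ### The weak-ACCP property -/

section WeakACCP

variable {F : Type*} [Field F] {p : ℕ → ℕ}

local notation "ψ" => toOrderZeroLocalization F (gramsMonoid p)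

theorem hasIrreducibleFactors_single (hp : ∀ n, (p (n + 1)).Prime)
    (hodd : ∀ n, Odd (p (n + 1))) (hinj : Function.Injective fun n => p (n + 1))
    (m : gramsMonoid p) : HasIrreducibleFactors (ψ (AddMonoidAlgebra.single m 1)) := by
  obtain ⟨x, hx⟩ := m
  induction hx using AddSubmonoid.closure_induction with
  | mem x h =>
    obtain ⟨n, hn, rfl⟩ := h
    obtain ⟨n, rfl⟩ := Nat.exists_eq_add_of_le' hn
    refine (irreducible_toOrderZeroLocalization_single (fun h => ?_)
      (sumLengthLE_gramsGen hp hodd hinj n rfl)).hasIrreducibleFactors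
    have h0 := congrArg Subtype.val h
    simp [(hp n).ne_zero] at h0
  | zero =>
    refine IsUnit.hasIrreducibleFactors (isUnit_toOrderZeroLocalization_iff.mpr ?_)
    exact (Finsupp.single_eq_same (a := (0 : gramsMonoid p))).trans_ne one_ne_zero
  | add x y hx hy ihx ihy =>
    have := ihx.mul ihy
    rw [← map_mul, AddMonoidAlgebra.single_mul_single, one_mul] at this
    exact this

/-- `exists_common_summand` is applied to all exponents of all numerators at once; denominators are
units and do not matter. -/
theorem exists_common_factor (hp : ∀ n, (p (n + 1)).Prime)
    (hodd : ∀ n, Odd (p (n + 1))) (hinj : Function.Injective fun n => p (n + 1))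
    (S : Finset (orderZeroLocalization F (gramsMonoid p))) (hS : S.Nonempty) (h0 : 0 ∉ S) :
    ∃ m : gramsMonoid p, (∀ s ∈ S, ψ (AddMonoidAlgebra.single m 1) ∣ s) ∧
      ∃ s ∈ S, ∃ t, s = ψ (AddMonoidAlgebra.single m 1) * t ∧ ∃ k, FactorLengthLE t k := by
  classical
  choose f u hu hf using fun x : orderZeroLocalization F (gramsMonoid p) =>
    exists_mul_toOrderZeroLocalization_eq x
  have hf0 : ∀ s ∈ S, f s ≠ 0 := by
    intro s hs h
    have := hf s
    rw [h, map_zero] at this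
    rcases mul_eq_zero.mp this with h1 | h1
    · exact h0 (h1 ▸ hs)
    · exact (isUnit_toOrderZeroLocalization_of_mem (hu s)).ne_zero h1
  obtain ⟨s₁, hs₁⟩ := hS
  obtain ⟨g₁, hg₁⟩ := Finsupp.support_nonempty_iff.mpr
    (AddMonoidAlgebra.coeff_eq_zero.not.mpr (hf0 s₁ hs₁))
  obtain ⟨m, hm, e, k, hme, hk⟩ := exists_common_summand hp hodd hinj
    (S.biUnion fun s => (f s).coeff.support) ⟨g₁, Finset.mem_biUnion.mpr ⟨s₁, hs₁, hg₁⟩⟩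
  have hdiv : ∀ s ∈ S, ∃ t f', s = ψ (AddMonoidAlgebra.single m 1) * t ∧
      t * ψ (u s) = ψ f' ∧ ∀ g, f'.coeff g = (f s).coeff (m + g) := by
    intro s hs
    obtain ⟨f', hf', hcoeff⟩ := exists_eq_single_mul (f := f s) (m := m) fun g hg =>
      hm g (Finset.mem_biUnion.mpr ⟨s, hs, Finsupp.mem_support_iff.mpr hg⟩)
    have hunit := isUnit_toOrderZeroLocalization_of_mem (hu s)
    obtain ⟨v, hv⟩ := hunit.exists_right_inv
    refine ⟨ψ f' * v, f', hunit.mul_right_cancel ?_, ?_, hcoeff⟩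
    · rw [hf s, hf', map_mul]
      linear_combination (-(ψ (AddMonoidAlgebra.single m 1) * ψ f')) * hv
    · linear_combination ψ f' * hv
  refine ⟨m, fun s hs => ?_, ?_⟩
  · obtain ⟨t, -, ht, -⟩ := hdiv s hs
    exact ⟨t, ht⟩
  · obtain ⟨s, hs, hsupp⟩ := Finset.mem_biUnion.mp hme
    obtain ⟨t, f', ht, hf', hcoeff⟩ := hdiv s hs
    exact ⟨s, hs, t, ht, k, factorLengthLE_of_mul_eq hf' hk
      (by rw [hcoeff]; exact Finsupp.mem_support_iff.mp hsupp)⟩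

theorem isWeakACCPDomain_orderZeroLocalization_gramsMonoid (hp : ∀ n, (p (n + 1)).Prime)
    (hodd : ∀ n, Odd (p (n + 1))) (hinj : Function.Injective fun n => p (n + 1)) :
    IsWeakACCPDomain (orderZeroLocalization F (gramsMonoid p)) := by
  refine ⟨fun x hx hu => ?_, fun S hS h0 => ?_⟩
  · obtain ⟨m, -, s, hs, t, hst, k, hk⟩ := exists_common_factor hp hodd hinj {x}
      (Finset.singleton_nonempty x) (by simpa using hx.symm)
    rw [Finset.mem_singleton] at hs
    subst hs
    refine HasIrreducibleFactors.exists_prod_eq ?_ hu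
    rw [hst]
    exact (hasIrreducibleFactors_single hp hodd hinj m).mul hk.hasIrreducibleFactors
  · obtain ⟨m, hdvd, s, hs, t, hst, k, hk⟩ := exists_common_factor hp hodd hinj S hS h0
    exact ⟨_, hdvd, s, hs, t, hst, hk.satisfiesACCP⟩

end WeakACCP

/-! ### The intersection as a dyadic localization -/

section Intersection

variable {F : Type*} [Field F]

theorem orderZeroLocalization_mono {G G' : AddSubmonoid ℚ≥0} (h : G ≤ G') :
    orderZeroLocalization F G ≤ orderZeroLocalization F G' := by
  have hcomp : ∀ f : AddMonoidAlgebra F G, toRatFractions F G f =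
      toRatFractions F G'
        (AddMonoidAlgebra.mapDomainRingHom F (AddSubmonoid.inclusion h) f) := by
    intro f
    induction f using AddMonoidAlgebra.induction_linear with
    | zero => simp
    | add f g hf hg => rw [map_add, map_add, map_add, hf, hg]
    | single a r => simp [toRatFractions, inclRat]
  intro x hx
  obtain ⟨f, s, hs, hfs⟩ := mem_orderZeroLocalization.mp hx
  refine mem_orderZeroLocalization.mpr ⟨_, _, ?_, (hcomp s ▸ hcomp f ▸ hfs :)⟩
  rw [mem_orderZero] at hs ⊢
  have := Finsupp.mapDomain_apply (AddSubmonoid.inclusion_injective h) s.coeff 0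
  rw [map_zero] at this
  exact this.trans_ne hs

/-- The additive projection of `F[ℚ]` discarding the exponents outside a subgroup. -/
noncomputable def restrictExponents (F : Type*) [Field F] (H : AddSubgroup ℚ) :
    AddMonoidAlgebra F ℚ →+ AddMonoidAlgebra F ℚ := by
  classical
  exact AddMonoidAlgebra.coeffAddEquiv.symm.toAddMonoidHom.comp
    ((Finsupp.filterAddHom (· ∈ H)).comp AddMonoidAlgebra.coeffAddEquiv.toAddMonoidHom)

theorem coeff_restrictExponents_of_mem {H : AddSubgroup ℚ} (f : AddMonoidAlgebra F ℚ) {x : ℚ}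
    (hx : x ∈ H) : (restrictExponents F H f).coeff x = f.coeff x := by
  classical
  exact Finsupp.filter_apply_pos (· ∈ H) f.coeff hx

theorem coeff_restrictExponents_of_notMem {H : AddSubgroup ℚ} (f : AddMonoidAlgebra F ℚ) {x : ℚ}
    (hx : x ∉ H) : (restrictExponents F H f).coeff x = 0 := by
  classical
  exact Finsupp.filter_apply_neg (· ∈ H) f.coeff hx

/-- Translation by an element of the subgroup `H` preserves both `H` and its complement. -/
theorem restrictExponents_mapDomain_mul {G : AddSubmonoid ℚ≥0} {H : AddSubgroup ℚ}
    (hG : ∀ g : G, inclRat G g ∈ H) (f : AddMonoidAlgebra F G) (t : AddMonoidAlgebra F ℚ) :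
    restrictExponents F H (AddMonoidAlgebra.mapDomainRingHom F (inclRat G) f * t) =
      AddMonoidAlgebra.mapDomainRingHom F (inclRat G) f * restrictExponents F H t := by
  induction f using AddMonoidAlgebra.induction_linear with
  | zero => simp
  | add f g hf hg => rw [map_add, add_mul, map_add, hf, hg, add_mul]
  | single a r =>
    ext x
    have hiff : -inclRat G a + x ∈ H ↔ x ∈ H := H.add_mem_cancel_left (H.neg_mem (hG a))
    rw [AddMonoidAlgebra.mapDomainRingHom_apply, AddMonoidAlgebra.mapDomain_single,
      AddMonoidAlgebra.coeff_single_mul_apply]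
    by_cases hx : x ∈ H
    · rw [coeff_restrictExponents_of_mem _ hx, coeff_restrictExponents_of_mem _ (hiff.mpr hx),
        AddMonoidAlgebra.coeff_single_mul_apply]
    · rw [coeff_restrictExponents_of_notMem _ hx,
        coeff_restrictExponents_of_notMem _ (hiff.not.mpr hx), mul_zero]

theorem exists_mapDomain_eq_restrictExponents {G D : AddSubmonoid ℚ≥0} {H : AddSubgroup ℚ}
    (hD : ∀ x ∈ G, (x : ℚ) ∈ H → x ∈ D) (f : AddMonoidAlgebra F G) :
    ∃ f' : AddMonoidAlgebra F D, AddMonoidAlgebra.mapDomainRingHom F (inclRat D) f' =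
        restrictExponents F H (AddMonoidAlgebra.mapDomainRingHom F (inclRat G) f) ∧
      f'.coeff 0 = f.coeff 0 := by
  set t := restrictExponents F H (AddMonoidAlgebra.mapDomainRingHom F (inclRat G) f) with ht
  obtain ⟨c, hc⟩ : t.coeff ∈ Set.range (Finsupp.mapDomain (inclRat D)) := by
    rw [Finsupp.mem_range_mapDomain_iff _ (inclRat_injective D)]
    intro b hb
    by_cases hbH : b ∈ H
    · rw [ht, coeff_restrictExponents_of_mem _ hbH]
      by_contra hne
      obtain ⟨g, rfl⟩ := Finsupp.mem_range_of_mapDomain_ne_zero hne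
      exact hb ⟨⟨g.1, hD g.1 g.2 hbH⟩, rfl⟩
    · exact coeff_restrictExponents_of_notMem _ hbH
  refine ⟨.ofCoeff c, AddMonoidAlgebra.coeff_injective hc, ?_⟩
  have h1 := Finsupp.mapDomain_apply (inclRat_injective D) c 0
  have h2 := Finsupp.mapDomain_apply (inclRat_injective G) f.coeff 0
  rw [map_zero] at h1 h2
  rw [← h2]
  refine h1.symm.trans ?_
  rw [hc, ht, coeff_restrictExponents_of_mem _ H.zero_mem]
  rfl

/-- Projecting `f * t = s * g` to exponents in `H` alters only `t` and `g`; as `0 ∈ H`, the new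
denominator still has order `0`. -/
theorem orderZeroLocalization_inf_le {G₁ G₂ D : AddSubmonoid ℚ≥0} {H : AddSubgroup ℚ}
    (h₁ : ∀ x ∈ G₁, (x : ℚ) ∈ H) (h₂ : ∀ x ∈ G₂, (x : ℚ) ∈ H → x ∈ D) :
    orderZeroLocalization F G₁ ⊓ orderZeroLocalization F G₂ ≤ orderZeroLocalization F D := by
  rintro x ⟨hx₁, hx₂⟩
  obtain ⟨f, s, hs, hfs⟩ := mem_orderZeroLocalization.mp hx₁
  obtain ⟨g, t, ht, hgt⟩ := mem_orderZeroLocalization.mp hx₂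
  obtain ⟨t', ht', ht0⟩ := exists_mapDomain_eq_restrictExponents h₂ t
  obtain ⟨g', hg', -⟩ := exists_mapDomain_eq_restrictExponents h₂ g
  refine mem_orderZeroLocalization.mpr ⟨g', t', ?_, ?_⟩
  · rw [mem_orderZero] at ht ⊢
    rwa [ht0]
  have heq : AddMonoidAlgebra.mapDomainRingHom F (inclRat G₁) f *
      AddMonoidAlgebra.mapDomainRingHom F (inclRat G₂) t =
      AddMonoidAlgebra.mapDomainRingHom F (inclRat G₁) s *
      AddMonoidAlgebra.mapDomainRingHom F (inclRat G₂) g := by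
    apply IsFractionRing.injective (AddMonoidAlgebra F ℚ) (RatFractions F)
    rw [map_mul, map_mul]
    change toRatFractions F G₁ f * toRatFractions F G₂ t =
      toRatFractions F G₁ s * toRatFractions F G₂ g
    rw [← hfs, ← hgt]
    ring
  have hG : ∀ g : G₁, inclRat G₁ g ∈ H := fun g => h₁ g.1 g.2
  have hres := congrArg (restrictExponents F H) heq
  rw [restrictExponents_mapDomain_mul hG, restrictExponents_mapDomain_mul hG, ← ht', ← hg'] at hres
  have hfrac : toRatFractions F G₁ f * toRatFractions F D t' =
      toRatFractions F G₁ s * toRatFractions F D g' := by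
    have := congrArg (algebraMap _ (RatFractions F)) hres
    rwa [map_mul, map_mul] at this
  refine (isUnit_toRatFractions F G₁ ⟨s, hs⟩).mul_left_cancel ?_
  rw [← hfrac, ← hfs]
  ring

theorem orderZeroLocalization_gramsMonoid_inf {p q : ℕ → ℕ}
    (hp : ∀ n, (p (n + 1)).Prime) (hq : ∀ n, (q (n + 1)).Prime)
    (hqodd : ∀ n, Odd (q (n + 1))) (hqinj : Function.Injective fun n => q (n + 1))
    (hpq : ∀ m n, p (m + 1) ≠ q (n + 1)) :
    orderZeroLocalization F (gramsMonoid p) ⊓ orderZeroLocalization F (gramsMonoid q) =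
      orderZeroLocalization F nonnegDyadic := by
  have hfact : ∀ n, Fact (q (n + 1)).Prime := fun n => ⟨hq n⟩
  -- `H` consists of the rationals integral at every `q (n + 1)`. It contains the first monoid,
  -- whose odd primes are different, and meets the second only in dyadics: integrality makes each
  -- reduced coefficient divisible by its prime, hence `0`.
  refine le_antisymm (orderZeroLocalization_inf_le
    (H := ⨅ n, (ratPadicInt (q (n + 1))).toAddSubgroup) ?_ ?_)
    (le_inf (orderZeroLocalization_mono (nonnegDyadic_le_gramsMonoid hp))
      (orderZeroLocalization_mono (nonnegDyadic_le_gramsMonoid hq)))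
  · intro x hx
    obtain ⟨c, rfl⟩ := mem_gramsMonoid_iff.mp hx
    rw [AddSubgroup.mem_iInf]
    exact fun n => coe_gramsWeight_mem_ratPadicInt hp (hqodd n) c fun m _ => hpq m n
  · intro x hx hH
    rw [AddSubgroup.mem_iInf] at hH
    obtain ⟨c, rfl⟩ := mem_gramsMonoid_iff.mp hx
    obtain ⟨m, hm, c', hc', hcc'⟩ := exists_nonnegDyadic_add_gramsWeight hq c
    suffices c' = 0 by rw [hcc', this, map_zero, add_zero]; exact hm
    ext n
    have hd : ((q (n + 1) : ℕ) : ℤ) ∣ c' n - (0 : ℕ →₀ ℕ) n :=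
      dvd_sub_of_gramsWeight_sub_mem hq hqinj n (hqodd n) (by
        have := sub_mem (show _ ∈ ratPadicInt (q (n + 1)) from hH n)
          (coe_mem_ratPadicInt_of_mem_nonnegDyadic (hqodd n) hm)
        rw [hcc'] at this
        simpa using this)
    rw [Finsupp.zero_apply, Nat.cast_zero, sub_zero, Int.natCast_dvd_natCast] at hd
    exact Nat.eq_zero_of_dvd_of_lt hd (hc' n)

end Intersection

/-! ### Absence of irreducibles over the dyadics -/

section Antimatter

variable {F : Type*} [Field F]

theorem isAntimatterDomain_orderZeroLocalization_nonnegDyadic :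
    IsAntimatterDomain (orderZeroLocalization F nonnegDyadic) := by
  intro x hx
  obtain ⟨f, s, hs, hfs⟩ := exists_mul_toOrderZeroLocalization_eq x
  have hunit := isUnit_toOrderZeroLocalization_of_mem hs
  have hf0 : f.coeff 0 = 0 := by
    have := hx.not_isUnit
    rwa [isUnit_iff_of_mul_eq hs hfs, not_not] at this
  have hf : f ≠ 0 := by
    rintro rfl
    rw [map_zero] at hfs
    exact mul_ne_zero hx.ne_zero hunit.ne_zero hfs
  obtain ⟨d, hd, hmin⟩ := f.coeff.support.exists_min_image id
    (Finsupp.support_nonempty_iff.mpr (AddMonoidAlgebra.coeff_eq_zero.not.mpr hf))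
  rw [Finsupp.mem_support_iff] at hd
  have hd0 : d.1 ≠ 0 := fun h => hd (by rw [show d = 0 from Subtype.ext h, hf0])
  have hlt : d.1 / 2 < d.1 := half_lt_self (pos_iff_ne_zero.mpr hd0)
  -- The monomial at half the least exponent `d > 0` divides `f`, and the cofactor still has only
  -- positive exponents.
  set e : nonnegDyadic := ⟨d.1 / 2, half_mem_nonnegDyadic d.2⟩ with he
  obtain ⟨f', hf', hcoeff⟩ := exists_eq_single_mul (f := f) (m := e) fun g hg => by
    have hdg : d.1 ≤ g.1 := hmin g (Finsupp.mem_support_iff.mpr hg)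
    obtain ⟨a, ha, hga⟩ := exists_add_eq_of_le_of_mem_nonnegDyadic e.2 g.2 (hlt.le.trans hdg)
    exact ⟨⟨a, ha⟩, Subtype.ext hga⟩
  obtain ⟨v, hv⟩ := hunit.exists_right_inv
  have hxe : x = toOrderZeroLocalization F nonnegDyadic (AddMonoidAlgebra.single e 1) *
      (toOrderZeroLocalization F nonnegDyadic f' * v) := by
    rw [← mul_assoc, ← map_mul, ← hf', ← hfs, mul_assoc, hv, mul_one]
  rcases hx.isUnit_or_isUnit hxe with h | h
  · refine isUnit_toOrderZeroLocalization_iff.mp h (Finsupp.single_eq_of_ne fun h0 => ?_)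
    exact hd0 (by simpa [he] using (congrArg Subtype.val h0).symm)
  · refine isUnit_toOrderZeroLocalization_iff.mp (isUnit_of_mul_isUnit_left h) ?_
    rw [hcoeff, add_zero]
    by_contra hne
    exact hlt.not_ge (hmin e (Finsupp.mem_support_iff.mpr hne))

theorem not_isAtomicDomain_orderZeroLocalization_nonnegDyadic :
    ¬ IsAtomicDomain (orderZeroLocalization F nonnegDyadic) := by
  intro h
  have hone : (1 : ℚ≥0) ∈ nonnegDyadic := ⟨1, 0, by simp⟩
  have hnu : ¬ IsUnit (toOrderZeroLocalization F nonnegDyadic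
      (AddMonoidAlgebra.single ⟨1, hone⟩ 1)) := by
    rw [isUnit_toOrderZeroLocalization_iff, not_not]
    exact Finsupp.single_eq_of_ne fun h0 => zero_ne_one (congrArg Subtype.val h0)
  obtain ⟨s, hs, hprod⟩ := h _ (fun h0 => by
    have := toOrderZeroLocalization_injective (h0.trans (map_zero _).symm)
    exact one_ne_zero (AddMonoidAlgebra.single_eq_zero.mp this)) hnu
  obtain rfl | ⟨a, ha⟩ := s.empty_or_exists_mem
  · exact hnu (hprod ▸ by simp)
  · exact isAntimatterDomain_orderZeroLocalization_nonnegDyadic a (hs a ha)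

end Antimatter

/-! ### Conclusion and existence of interlacing primes -/

theorem weakACCP_and_antimatter_inf (F : Type*) [Field F] (p q : ℕ → ℕ)
    (hprime : ∀ n, 1 ≤ n → (p n).Prime ∧ Odd (p n) ∧ (q n).Prime ∧ Odd (q n))
    (hlt : ∀ n, 1 ≤ n → p n < q n ∧ q n < p (n + 1)) :
    let L₁ := orderZeroLocalization F (gramsMonoid p)
    let L₂ := orderZeroLocalization F (gramsMonoid q)
    IsWeakACCPDomain L₁ ∧ IsWeakACCPDomain L₂ ∧
      IsAntimatterDomain (L₁ ⊓ L₂ : Subring (RatFractions F)) ∧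
      ¬ IsAtomicDomain (L₁ ⊓ L₂ : Subring (RatFractions F)) := by
  intro L₁ L₂
  have hp : ∀ n, (p (n + 1)).Prime := fun n => (hprime _ n.succ_pos).1
  have hpodd : ∀ n, Odd (p (n + 1)) := fun n => (hprime _ n.succ_pos).2.1
  have hq : ∀ n, (q (n + 1)).Prime := fun n => (hprime _ n.succ_pos).2.2.1
  have hqodd : ∀ n, Odd (q (n + 1)) := fun n => (hprime _ n.succ_pos).2.2.2
  have hpmono : StrictMono fun n => p (n + 1) := strictMono_nat_of_lt_succ fun n =>
    (hlt _ n.succ_pos).1.trans (hlt _ n.succ_pos).2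
  have hqmono : StrictMono fun n => q (n + 1) := strictMono_nat_of_lt_succ fun n =>
    (hlt _ n.succ_pos).2.trans (hlt _ (n + 1).succ_pos).1
  have hpq : ∀ m n, p (m + 1) ≠ q (n + 1) := by
    intro m n
    rcases le_or_gt m n with h | h
    · exact ((hpmono.monotone h).trans_lt (hlt _ n.succ_pos).1).ne
    · exact ((hlt _ n.succ_pos).2.trans_le (hpmono.monotone (Nat.succ_le_of_lt h))).ne'
  have hinf : L₁ ⊓ L₂ = orderZeroLocalization F nonnegDyadic :=
    orderZeroLocalization_gramsMonoid_inf hp hq hqodd hqmono.injective hpq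
  rw [hinf]
  exact ⟨isWeakACCPDomain_orderZeroLocalization_gramsMonoid hp hpodd hpmono.injective,
    isWeakACCPDomain_orderZeroLocalization_gramsMonoid hq hqodd hqmono.injective,
    isAntimatterDomain_orderZeroLocalization_nonnegDyadic,
    not_isAtomicDomain_orderZeroLocalization_nonnegDyadic⟩

theorem exists_interlacing_odd_primes : ∃ p q : ℕ → ℕ,
    (∀ n, 1 ≤ n → (p n).Prime ∧ Odd (p n) ∧ (q n).Prime ∧ Odd (q n)) ∧
      ∀ n, 1 ≤ n → p n < q n ∧ q n < p (n + 1) := by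
  have hmono := Nat.nth_strictMono Nat.infinite_setOfPred_prime
  have hodd : ∀ n, 1 ≤ n → Odd (Nat.nth Nat.Prime n) := fun n hn =>
    (Nat.prime_nth_prime n).odd_of_ne_two
      (Nat.nth_prime_zero_eq_two ▸ (hmono (Nat.lt_of_lt_of_le Nat.zero_lt_one hn)).ne')
  -- Alternate primes; the prime `2` has index `0`, which `1 ≤ n` excludes.
  refine ⟨fun n => Nat.nth Nat.Prime (2 * n), fun n => Nat.nth Nat.Prime (2 * n + 1),
    fun n hn => ⟨Nat.prime_nth_prime _, hodd _ (by omega), Nat.prime_nth_prime _,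
      hodd _ (by omega)⟩, fun n _ => ⟨hmono (by omega), hmono (by omega)⟩⟩

theorem mainTheorem11 :
    (∀ (F : Type*) [Field F] (p q : ℕ → ℕ),
      (∀ n, 1 ≤ n → (p n).Prime ∧ Odd (p n) ∧ (q n).Prime ∧ Odd (q n)) →
      (∀ n, 1 ≤ n → p n < q n ∧ q n < p (n + 1)) →
      let L₁ := orderZeroLocalization F (gramsMonoid p)
      let L₂ := orderZeroLocalization F (gramsMonoid q)
      IsWeakACCPDomain L₁ ∧ IsWeakACCPDomain L₂ ∧
        IsAntimatterDomain (L₁ ⊓ L₂ : Subring (RatFractions F)) ∧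
        ¬ IsAtomicDomain (L₁ ⊓ L₂ : Subring (RatFractions F))) ∧
    (∃ (K : Type) (_ : Field K) (A B : Subring K),
      IsWeakACCPDomain A ∧ IsWeakACCPDomain B ∧
        ¬ IsWeakACCPDomain (A ⊓ B : Subring K)) ∧
    (∃ (K : Type) (_ : Field K) (A B : Subring K),
      IsAtomicDomain A ∧ IsAtomicDomain B ∧ ¬ IsAtomicDomain (A ⊓ B : Subring K)) := by
  obtain ⟨p, q, hprime, hlt⟩ := exists_interlacing_odd_primes
  obtain ⟨h₁, h₂, -, hna⟩ := weakACCP_and_antimatter_inf ℚ p q hprime hlt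
  exact ⟨weakACCP_and_antimatter_inf,
    ⟨RatFractions ℚ, inferInstance, _, _, h₁, h₂, fun h => hna h.1⟩,
    ⟨RatFractions ℚ, inferInstance, _, _, h₁.1, h₂.1, hna⟩⟩
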